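/- **Setting.** Let $G$ be a finite two-player zero-sum game with perfect information and simultaneous moves, given as a finite tree: a terminal state $z$ has utility $u_1(z)\in[0,1]$ for player 1 and $1-u_1(z)$ for player 2; at an inner state $h$ the players simultaneously choose actions from finite nonempty sets $\mathcal A_1(h),\mathcal A_2(h)$, and the joint action $(i,j)$ leads to the child $h_{ij}$. Let $D$ be the maximal number of inner states on a path from the root. A *selection algorithm* $A$ is a randomized rule that, in a repeated game with finitely many actions, picks the next action from the history of own actions, opponent's actions and own received payoffs. * $A$ is *$\varepsilon$-Hannan consistent* if for all numbers of actions, every opponent and every payoff sequence with values in $[0,1]$ (where the opponent's action $j_s$ and the payoffs $a_i(s)$ of all own actions $i$ in round $s$ may depend on the past actions), the actions $i_s$ chosen by $A$ satisfy almost surely $$\limsup_{t\to\infty}\ \frac1t\Big(\max_i\sum_{s=1}^t a_{i}(s)-\sum_{s=1}^t a_{i_s}(s)\Big)\le\varepsilon .$$ * $A$ has *guaranteed exploration* if, whenever both players use $A$ with independent randomness in a repeated game whose payoffs lie in $[0,1]$ and may depend on the past joint actions, almost surely every joint action $(i,j)$ is played infinitely often. SM-MCTS with propagation of means is run on the completely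 built tree of $G$, each player using at every inner state a separate copy of $A$ with independent randomness. In one simulation, started at the root, a terminal state $z$ returns $u_1(z)$. At an inner state $h$ both copies select actions $i,j$, the simulation continues in $h_{ij}$, the returned value $x$ is reported to the copies at $h$ (as payoff $x$ to player 1 and $1-x$ to player 2), and $h$ returns the mean $X_h/n_h$ of all values received at $h$ so far, including $x$. Let $\hat\sigma(t)=(\hat\sigma_1(t),\hat\sigma_2(t))$ be given by the empirical frequencies of the actions chosen by the two players at each inner state during the first $t$ simulations. A profile of behavioral strategies is an *$\eta$-Nash equilibrium* if no player can increase their expected utility by more than $\eta$ by deviating unilaterally, and it is *subgame perfect* if this holds in the subgame rooted at every state. **Theorem.** Let $\varepsilon>0$ and let $A$ be an $\varepsilon$-Hannan consistent selection algorithm with guaranteed exploration. Then for every $\delta>0$, almost surely there is $t_0$ such that for all $t\ge t_0$ the profile $\hat\sigma(t)$ is a subgame-perfect $(2D^2+\delta)\varepsilon$-Nash equilibrium of $G$. -/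

import Mathlib

open MeasureTheory

noncomputable section

/-! Randomized selection algorithms for repeated matrix games -/

/-- What a player has seen in a repeated game in which this player has `m + 1` actions and the
opponent has `n + 1` actions: the list of triples (own action, opponent's action, own payoff),
most recent round first. -/
abbrev History (m n : ℕ) : Type := List (Fin (m + 1) × Fin (n + 1) × ℝ)

/-- The same play seen by the opponent, whose payoff is `1 - u`. -/
def History.flip {m n : ℕ} (l : History m n) : History n m :=
  l.map fun x => (x.2.1, x.1, 1 - x.2.2)

/-- A randomized selection algorithm: a deterministic rule that reads a random tape `ω : Ω` and
the history of play and returns the next action, for every size of the matrix game. The tape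
carries all random choices that the algorithm ever makes in one repeated game, so the rule may
depend on earlier random draws as well. -/
structure SelectionAlgorithm (Ω : Type*) [MeasurableSpace Ω] where
  select : (m n : ℕ) → Ω → History m n → Fin (m + 1)
  measurable_select : ∀ (m n : ℕ) (l : History m n), Measurable fun ω => select m n ω l

namespace SelectionAlgorithm

variable {Ω : Type*} [MeasurableSpace Ω]

/-- The first `t` rounds of a player with tape `ω` who uses `A` against an adaptive adversary.
In each round the adversary fixes, knowing the player's past actions (most recent first) but not
the current one, its own action `opp past` and the payoff `pay past i` of every action `i` of the
player. The player observes both actions and the payoff of the action that was chosen. -/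
def playAgainst (A : SelectionAlgorithm Ω) {m n : ℕ} (opp : List (Fin (m + 1)) → Fin (n + 1))
    (pay : List (Fin (m + 1)) → Fin (m + 1) → ℝ) (ω : Ω) : ℕ → History m n
  | 0 => []
  | t + 1 =>
    let l := playAgainst A opp pay ω t
    let past := l.map Prod.fst
    let i := A.select m n ω l
    (i, opp past, pay past i) :: l

/-- Cumulative payoff `G(t)` of the player. -/
def cumPayoff (A : SelectionAlgorithm Ω) {m n : ℕ} (opp : List (Fin (m + 1)) → Fin (n + 1))
    (pay : List (Fin (m + 1)) → Fin (m + 1) → ℝ) (ω : Ω) (t : ℕ) : ℝ :=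
  ((A.playAgainst opp pay ω t).map fun x => x.2.2).sum

/-- Maximum cumulative payoff `G_max(t)`: the best total payoff of a single fixed action against
the payoffs that occurred in the first `t` rounds. -/
def maxCumPayoff (A : SelectionAlgorithm Ω) {m n : ℕ} (opp : List (Fin (m + 1)) → Fin (n + 1))
    (pay : List (Fin (m + 1)) → Fin (m + 1) → ℝ) (ω : Ω) (t : ℕ) : ℝ :=
  Finset.univ.sup' Finset.univ_nonempty fun i : Fin (m + 1) =>
    ∑ s ∈ Finset.range t, pay ((A.playAgainst opp pay ω s).map Prod.fst) i

/-- Average regret `r(t) = (G_max(t) - G(t)) / t`. -/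
def avgRegret (A : SelectionAlgorithm Ω) {m n : ℕ} (opp : List (Fin (m + 1)) → Fin (n + 1))
    (pay : List (Fin (m + 1)) → Fin (m + 1) → ℝ) (ω : Ω) (t : ℕ) : ℝ :=
  (A.maxCumPayoff opp pay ω t - A.cumPayoff opp pay ω t) / t

/-- `ε`-Hannan consistency: in every matrix size, against every opponent and every (adaptively
generated) payoff sequence in `[0, 1]`, almost surely `limsup r(t) ≤ ε`. -/
def HannanConsistent (A : SelectionAlgorithm Ω) (μ : Measure Ω) (ε : ℝ) : Prop :=
  ∀ (m n : ℕ) (opp : List (Fin (m + 1)) → Fin (n + 1))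
    (pay : List (Fin (m + 1)) → Fin (m + 1) → ℝ),
    (∀ past i, pay past i ∈ Set.Icc (0 : ℝ) 1) →
      ∀ᵐ ω ∂μ, Filter.limsup (fun t : ℕ => A.avgRegret opp pay ω t) Filter.atTop ≤ ε

/-- The first `t` rounds of a repeated game in which both players use `A`, player 1 with tape
`ω.1` and player 2 with tape `ω.2`. The payoff table `tab past` of a round may depend on the past
joint actions (most recent first). Triples are (action of player 1, action of player 2, payoff of
player 1). -/
def playBoth (A : SelectionAlgorithm Ω) {m n : ℕ}
    (tab : List (Fin (m + 1) × Fin (n + 1)) → Fin (m + 1) → Fin (n + 1) → ℝ) (ω : Ω × Ω) :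
    ℕ → History m n
  | 0 => []
  | t + 1 =>
    let l := playBoth A tab ω t
    let i := A.select m n ω.1 l
    let j := A.select n m ω.2 l.flip
    (i, j, tab (l.map fun x => (x.1, x.2.1)) i j) :: l

/-- Guaranteed exploration: when both players use `A` (with independent tapes), almost surely
every joint action `(i, j)` is chosen infinitely often, `t_ij → ∞`, whatever the payoffs are. -/
def GuaranteedExploration (A : SelectionAlgorithm Ω) (μ : Measure Ω) : Prop :=
  ∀ (m n : ℕ) (tab : List (Fin (m + 1) × Fin (n + 1)) → Fin (m + 1) → Fin (n + 1) → ℝ),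
    (∀ past i j, tab past i j ∈ Set.Icc (0 : ℝ) 1) →
      ∀ᵐ ω ∂(μ.prod μ), ∀ (i : Fin (m + 1)) (j : Fin (n + 1)),
        Filter.Tendsto
          (fun t : ℕ => ((A.playBoth tab ω t).map fun x => (x.1, x.2.1)).count (i, j))
          Filter.atTop Filter.atTop

end SelectionAlgorithm

/-! Games -/

/-- Finite two-player zero-sum games with perfect information and simultaneous moves, as game
trees: a terminal state with utility `u ∈ [0, 1]` of player 1 (player 2 gets `1 - u`), or an inner
state in which player 1 has `m + 1` actions, player 2 has `n + 1` actions, and the joint action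
`p = (i, j)` leads to the state `child p`. -/
inductive SMGame : Type
  | terminal (u : Set.Icc (0 : ℝ) 1) : SMGame
  | node (m n : ℕ) (child : Fin (m + 1) × Fin (n + 1) → SMGame) : SMGame

namespace SMGame

/-- Maximal depth: the largest number of inner states on a path from the root (so that a matrix
game has depth 1). -/
def depth : SMGame → ℕ
  | terminal _ => 0
  | node _ _ c => (Finset.univ.sup fun p => (c p).depth) + 1

/-- Behavioral strategies of player 1, as families of weights on the actions at each inner state;
see `IsStrat₁`. -/
def Strat₁ : SMGame → Type
  | terminal _ => Unit
  | node m _ c => (Fin (m + 1) → ℝ) × (∀ p, Strat₁ (c p))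

/-- Behavioral strategies of player 2, as families of weights; see `IsStrat₂`. -/
def Strat₂ : SMGame → Type
  | terminal _ => Unit
  | node _ n c => (Fin (n + 1) → ℝ) × (∀ p, Strat₂ (c p))

/-- The weights at every inner state form a probability distribution. -/
def IsStrat₁ : (G : SMGame) → G.Strat₁ → Prop
  | terminal _, _ => True
  | node m _ c, σ => σ.1 ∈ stdSimplex ℝ (Fin (m + 1)) ∧ ∀ p, IsStrat₁ (c p) (σ.2 p)

/-- The weights at every inner state form a probability distribution. -/
def IsStrat₂ : (G : SMGame) → G.Strat₂ → Prop
  | terminal _, _ => True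
  | node _ n c, σ => σ.1 ∈ stdSimplex ℝ (Fin (n + 1)) ∧ ∀ p, IsStrat₂ (c p) (σ.2 p)

/-- Expected utility `u(σ₁, σ₂)` of player 1: the sum of the utilities of the terminal states,
each weighted by the product of the probabilities of all actions on the path to it. -/
def utility : (G : SMGame) → G.Strat₁ → G.Strat₂ → ℝ
  | terminal u, _, _ => u
  | node _ _ c, σ₁, σ₂ => ∑ p, σ₁.1 p.1 * σ₂.1 p.2 * utility (c p) (σ₁.2 p) (σ₂.2 p)

/-- `(σ₁, σ₂)` is an `η`-Nash equilibrium: a profile of behavioral strategies from which no player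
can gain more than `η` by deviating unilaterally. -/
def IsNash (G : SMGame) (η : ℝ) (σ₁ : G.Strat₁) (σ₂ : G.Strat₂) : Prop :=
  G.IsStrat₁ σ₁ ∧ G.IsStrat₂ σ₂ ∧
    (∀ σ₁', G.IsStrat₁ σ₁' → G.utility σ₁' σ₂ - G.utility σ₁ σ₂ ≤ η) ∧
    (∀ σ₂', G.IsStrat₂ σ₂' → G.utility σ₁ σ₂ - G.utility σ₁ σ₂' ≤ η)

/-- `(σ₁, σ₂)` is a subgame-perfect `η`-Nash equilibrium: its restriction to the subgame rooted at
any state is an `η`-Nash equilibrium of that subgame. -/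
def IsSubgamePerfect (η : ℝ) : (G : SMGame) → G.Strat₁ → G.Strat₂ → Prop
  | terminal u, σ₁, σ₂ => IsNash (terminal u) η σ₁ σ₂
  | node m n c, σ₁, σ₂ =>
    IsNash (node m n c) η σ₁ σ₂ ∧ ∀ p, IsSubgamePerfect η (c p) (σ₁.2 p) (σ₂.2 p)

/-! Simultaneous-move Monte Carlo tree search, propagating means, on the fully built tree -/

section Tapes

universe u

variable (Ω : Type u) [MeasurableSpace Ω]

/-- One tape for each player at each inner state. -/
def Tapes : SMGame → Type u
  | terminal _ => PUnit
  | node _ _ c => (Ω × Ω) × (∀ p, Tapes (c p))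

/-- Product σ-algebra. -/
instance instMeasurableSpaceTapes : (G : SMGame) → MeasurableSpace (G.Tapes Ω)
  | terminal _ => (inferInstance : MeasurableSpace PUnit)
  | node _ _ c =>
    letI := fun p => instMeasurableSpaceTapes (c p)
    (inferInstance : MeasurableSpace ((Ω × Ω) × (∀ p, Tapes Ω (c p))))

variable {Ω}

/-- All tapes are independent and have law `μ`. -/
def tapeMeasure (μ : Measure Ω) : (G : SMGame) → Measure (G.Tapes Ω)
  | terminal _ => (Measure.dirac PUnit.unit : Measure PUnit)
  | node _ _ c => (μ.prod μ).prod (Measure.pi fun p => tapeMeasure μ (c p))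

end Tapes

/-- The information kept by the search: at each inner state the list of triples (action of
player 1, action of player 2, returned value) of all visits, most recent first. -/
def SearchState : SMGame → Type
  | terminal _ => Unit
  | node m n c => History m n × (∀ p, SearchState (c p))

/-- Before the first simulation. -/
def initState : (G : SMGame) → G.SearchState
  | terminal _ => ()
  | node _ _ c => ([], fun p => initState (c p))

/-- The mean `X_h / n_h` of the values received at a state. -/
def meanValue {m n : ℕ} (l : History m n) : ℝ := (l.map fun x => x.2.2).sum / l.length

section Search

variable {Ω : Type*} [MeasurableSpace Ω]

/-- One simulation: the new search state and the returned value. At a terminal state its utility is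
returned. At an inner state both players select an action with `A` (player 2 sees the payoffs
`1 - u`), the simulation continues recursively from the successor state, the value that comes back
is recorded, and the updated mean `X_h / n_h` is returned. -/
def simulate (A : SelectionAlgorithm Ω) :
    (G : SMGame) → G.Tapes Ω → G.SearchState → G.SearchState × ℝ
  | terminal u, _, s => (s, u)
  | node m n c, τ, s =>
    let i := A.select m n τ.1.1 s.1
    let j := A.select n m τ.1.2 s.1.flip
    let r := simulate A (c (i, j)) (τ.2 (i, j)) (s.2 (i, j))
    let l : History m n := (i, j, r.2) :: s.1
    ((l, Function.update s.2 (i, j) r.1), meanValue l)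

/-- The search state after `t` simulations from the root. -/
def search (A : SelectionAlgorithm Ω) (G : SMGame) (τ : G.Tapes Ω) : ℕ → G.SearchState
  | 0 => G.initState
  | t + 1 => (G.simulate A τ (search A G τ t)).1

end Search

/-- Empirical frequencies of player 1: the weight of `i` at a state is the number of visits of this
state in which `i` was chosen, divided by the number of visits. -/
def empirical₁ : (G : SMGame) → G.SearchState → G.Strat₁
  | terminal _, _ => ()
  | node _ _ c, s =>
    (fun i => ((s.1.map fun x => x.1).count i : ℝ) / s.1.length, fun p => empirical₁ (c p) (s.2 p))

/-- Empirical frequencies of player 2. -/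
def empirical₂ : (G : SMGame) → G.SearchState → G.Strat₂
  | terminal _, _ => ()
  | node _ _ c, s =>
    (fun j => ((s.1.map fun x => x.2.1).count j : ℝ) / s.1.length,
      fun p => empirical₂ (c p) (s.2 p))

end SMGame

end

/-! Backward induction on the tree. The search below a child depends only on the tapes below it and
on the number of its visits. So the play at a state is a repeated game between two copies of `A` in
which the k-th play of a joint action pays the k-th value returned by that child (`search_node`).
These payoffs are functions of tapes independent of the two tapes at the state. By Fubini they may
be frozen, and so may the opponent's tape, which turns the opponent into an adaptive adversary.
Hence both hypotheses on `A` apply at every state almost surely.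

The rest is deterministic. Let the children have depth at most D and return their values up to Dε
asymptotically. Exploration makes every entry of the payoff table accurate in the long run,
including entries that are not played. Regret at most ε then means that, in the matrix of child
values and against the opponent's empirical frequencies, no action beats the mean payoff by more
than (D+1)ε (`eventually_sum_colFreq_le`). The bounds of both players put the mean within (D+1)ε of
the value of the state, and `searchConverges_node` adds up the gains from deviations over the
levels. -/

/-! ### Measurability of maps with countably many values -/

/-- A function with countable range and measurable fibers. -/
def DiscretelyMeasurable {X Y : Type*} [MeasurableSpace X] (f : X → Y) : Prop :=
  (Set.range f).Countable ∧ ∀ y, MeasurableSet (f ⁻¹' {y})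

namespace DiscretelyMeasurable

variable {X Y Z : Type*} [MeasurableSpace X]

theorem const (y : Y) : DiscretelyMeasurable fun _ : X => y :=
  ⟨(Set.countable_singleton y).mono (by rintro _ ⟨x, rfl⟩; rfl),
    fun z => MeasurableSet.const (y = z)⟩

theorem of_measurable [Countable Y] [MeasurableSpace Y] [MeasurableSingletonClass Y] {f : X → Y}
    (hf : Measurable f) : DiscretelyMeasurable f :=
  ⟨Set.to_countable _, fun y => hf (measurableSet_singleton y)⟩

/-- A countable range makes every preimage a countable union of fibers, so histories and search
states need no σ-algebra. -/
theorem measurableSet_preimage {f : X → Y} (hf : DiscretelyMeasurable f) (S : Set Y) :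
    MeasurableSet (f ⁻¹' S) := by
  have : f ⁻¹' S = ⋃ y ∈ Set.range f ∩ S, f ⁻¹' {y} := by
    ext x
    simp
  rw [this]
  exact MeasurableSet.biUnion (hf.1.mono Set.inter_subset_left) fun y _ => hf.2 y

theorem measurable [MeasurableSpace Y] {f : X → Y} (hf : DiscretelyMeasurable f) :
    Measurable f :=
  fun S _ => hf.measurableSet_preimage S

/-- Sequential computations are handled by freezing each of the countably many earlier outcomes; no
regularity of `F` in its second argument is needed. -/
theorem bind {f : X → Y} {F : X → Y → Z} (hf : DiscretelyMeasurable f)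
    (hF : ∀ y, DiscretelyMeasurable fun x => F x y) :
    DiscretelyMeasurable fun x => F x (f x) := by
  constructor
  · refine (hf.1.biUnion fun y _ => (hF y).1).mono ?_
    rintro _ ⟨x, rfl⟩
    exact Set.mem_biUnion ⟨x, rfl⟩ ⟨x, rfl⟩
  · intro z
    have : (fun x => F x (f x)) ⁻¹' {z} =
        ⋃ y ∈ Set.range f, f ⁻¹' {y} ∩ (fun x => F x y) ⁻¹' {z} := by
      ext x
      constructor
      · exact fun h => Set.mem_biUnion ⟨x, rfl⟩ ⟨rfl, h⟩
      · simp only [Set.mem_iUnion]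
        rintro ⟨_, _, rfl, h⟩
        exact h
    rw [this]
    exact MeasurableSet.biUnion hf.1 fun y _ => (hf.2 y).inter ((hF y).2 z)

theorem map {f : X → Y} (hf : DiscretelyMeasurable f) (g : Y → Z) :
    DiscretelyMeasurable fun x => g (f x) :=
  hf.bind (F := fun _ y => g y) fun y => const (g y)

theorem comp_measurable {W : Type*} [MeasurableSpace W] {f : X → Y} {h : W → X}
    (hf : DiscretelyMeasurable f) (hh : Measurable h) : DiscretelyMeasurable fun w => f (h w) :=
  ⟨hf.1.mono (by rintro _ ⟨w, rfl⟩; exact ⟨h w, rfl⟩), fun y => hh (hf.2 y)⟩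

end DiscretelyMeasurable

/-! ### Histories and the exchange of the two players -/

/-- The joint actions of a play, most recent first. -/
def History.joint {m n : ℕ} (l : History m n) : List (Fin (m + 1) × Fin (n + 1)) :=
  l.map fun x => (x.1, x.2.1)

/-- Cumulative payoff of the first player. -/
def History.payoff {m n : ℕ} (l : History m n) : ℝ := (l.map fun x => x.2.2).sum

theorem History.flip_flip {m n : ℕ} (l : History m n) : l.flip.flip = l := by
  induction l with
  | nil => rfl
  | cons x l ih => simp_all [History.flip]

theorem History.joint_flip {m n : ℕ} (l : History m n) :
    l.flip.joint = l.joint.map Prod.swap := by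
  simp [History.flip, History.joint, Function.comp_def]

theorem History.payoff_flip {m n : ℕ} (l : History m n) :
    l.flip.payoff = l.length - l.payoff := by
  induction l with
  | nil => simp [History.flip, History.payoff]
  | cons x l ih =>
    simp only [History.flip, History.payoff, List.map_cons, List.sum_cons, List.length_cons] at ih ⊢
    rw [ih]
    push_cast
    ring

theorem List.count_map_swap {α β : Type*} [DecidableEq α] [DecidableEq β] (l : List (α × β))
    (p : β × α) : (l.map Prod.swap).count p = l.count p.swap := by
  conv_lhs => rw [← Prod.swap_swap p]
  exact List.count_map_of_injective l Prod.swap Prod.swap_injective p.swap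

/-- Payoff tables that depend on the past joint actions. -/
abbrev PayoffTable (m n : ℕ) : Type :=
  List (Fin (m + 1) × Fin (n + 1)) → Fin (m + 1) → Fin (n + 1) → ℝ

/-- The payoff tables from the perspective of the second player. -/
def PayoffTable.flip {m n : ℕ} (tab : PayoffTable m n) : PayoffTable n m :=
  fun past j i => 1 - tab (past.map Prod.swap) i j

/-! ### The repeated game between two copies of the algorithm -/

namespace SelectionAlgorithm

variable {Ω : Type*} [MeasurableSpace Ω] (A : SelectionAlgorithm Ω) {m n : ℕ}

/-- The action of the first player in round `t`. -/
def rowAction (tab : PayoffTable m n) (ω : Ω × Ω) (t : ℕ) : Fin (m + 1) :=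
  A.select m n ω.1 (A.playBoth tab ω t)

/-- The action of the second player in round `t`. -/
def colAction (tab : PayoffTable m n) (ω : Ω × Ω) (t : ℕ) : Fin (n + 1) :=
  A.select n m ω.2 (A.playBoth tab ω t).flip

theorem playBoth_succ (tab : PayoffTable m n) (ω : Ω × Ω) (t : ℕ) :
    A.playBoth tab ω (t + 1) =
      (A.rowAction tab ω t, A.colAction tab ω t,
        tab (A.playBoth tab ω t).joint (A.rowAction tab ω t) (A.colAction tab ω t)) ::
          A.playBoth tab ω t := rfl

theorem length_playBoth (tab : PayoffTable m n) (ω : Ω × Ω) (t : ℕ) :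
    (A.playBoth tab ω t).length = t := by
  induction t with
  | zero => rfl
  | succ t ih => rw [playBoth_succ, List.length_cons, ih]

/-- This symmetry reduces every statement about the second player to one about the first. -/
theorem playBoth_flip (tab : PayoffTable m n) (ω : Ω × Ω) (t : ℕ) :
    A.playBoth tab.flip ω.swap t = (A.playBoth tab ω t).flip := by
  induction t with
  | zero => rfl
  | succ t ih =>
    rw [playBoth_succ, playBoth_succ]
    simp only [rowAction, colAction, ih, History.flip_flip, PayoffTable.flip, History.joint_flip,
      List.map_map, Prod.swap_swap_eq, List.map_id, Prod.fst_swap, Prod.snd_swap]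
    rfl

/-- Average regret of the first player in a game between two copies of `A`. -/
noncomputable def rowRegret (tab : PayoffTable m n) (ω : Ω × Ω) (t : ℕ) : ℝ :=
  ((Finset.univ.sup' Finset.univ_nonempty fun i : Fin (m + 1) =>
    ∑ s ∈ Finset.range t, tab (A.playBoth tab ω s).joint i (A.colAction tab ω s)) -
      (A.playBoth tab ω t).payoff) / t

/-- The play against a copy of `A` with tape `ω₂`, as a function of the own past actions. -/
def replay (tab : PayoffTable m n) (ω₂ : Ω) : List (Fin (m + 1)) → History m n
  | [] => []
  | i :: past =>
    let l := replay tab ω₂ past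
    let j := A.select n m ω₂ l.flip
    (i, j, tab l.joint i j) :: l

/-- The adversary that a copy of `A` with tape `ω₂` is for the first player. -/
def adversary (tab : PayoffTable m n) (ω₂ : Ω) (past : List (Fin (m + 1))) : Fin (n + 1) :=
  A.select n m ω₂ (A.replay tab ω₂ past).flip

/-- The payoffs that the first player faces when the second one uses `A` with tape `ω₂`. -/
def adversaryPayoff (tab : PayoffTable m n) (ω₂ : Ω) (past : List (Fin (m + 1)))
    (i : Fin (m + 1)) : ℝ :=
  tab (A.replay tab ω₂ past).joint i (A.adversary tab ω₂ past)

theorem replay_playBoth (tab : PayoffTable m n) (ω : Ω × Ω) (t : ℕ) :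
    A.replay tab ω.2 ((A.playBoth tab ω t).map Prod.fst) = A.playBoth tab ω t := by
  induction t with
  | zero => rfl
  | succ t ih =>
    rw [playBoth_succ, List.map_cons, replay]
    simp only [ih]
    rfl

/-- Once the second tape is fixed, the whole play can be reconstructed from the first player's
actions, so the second player is an adversary as in `HannanConsistent`. -/
theorem playAgainst_adversary (tab : PayoffTable m n) (ω : Ω × Ω) (t : ℕ) :
    A.playAgainst (A.adversary tab ω.2) (A.adversaryPayoff tab ω.2) ω.1 t =
      A.playBoth tab ω t := by
  induction t with
  | zero => rfl
  | succ t ih =>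
    rw [playAgainst, playBoth_succ]
    simp only [ih, adversary, adversaryPayoff, replay_playBoth]
    rfl

theorem avgRegret_adversary (tab : PayoffTable m n) (ω : Ω × Ω) (t : ℕ) :
    A.avgRegret (A.adversary tab ω.2) (A.adversaryPayoff tab ω.2) ω.1 t =
      A.rowRegret tab ω t := by
  simp only [avgRegret, maxCumPayoff, cumPayoff, playAgainst_adversary, adversaryPayoff,
    adversary, replay_playBoth]
  rfl

/-! ### Almost sure regret and exploration for random payoff tables -/

section Measurability

variable {X : Type*} [MeasurableSpace X] {tab : X → PayoffTable m n}

theorem discretelyMeasurable_select (l : History m n) :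
    DiscretelyMeasurable fun ω => A.select m n ω l :=
  .of_measurable (A.measurable_select m n l)

theorem discretelyMeasurable_playBoth
    (htab : ∀ past i j, DiscretelyMeasurable fun x => tab x past i j) (t : ℕ) :
    DiscretelyMeasurable fun z : (Ω × Ω) × X => A.playBoth (tab z.2) z.1 t := by
  induction t with
  | zero => exact .const []
  | succ t ih =>
    refine ih.bind (F := fun z l =>
      (A.select m n z.1.1 l, A.select n m z.1.2 l.flip,
        tab z.2 l.joint (A.select m n z.1.1 l) (A.select n m z.1.2 l.flip)) :: l) fun l => ?_
    refine ((A.discretelyMeasurable_select l).comp_measurable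
      (measurable_fst.comp measurable_fst)).bind (F := fun (z : (Ω × Ω) × X) i =>
      (i, A.select n m z.1.2 l.flip, tab z.2 l.joint i (A.select n m z.1.2 l.flip)) :: l)
      fun i => ?_
    refine ((A.discretelyMeasurable_select l.flip).comp_measurable
      (measurable_snd.comp measurable_fst)).bind (F := fun (z : (Ω × Ω) × X) j =>
      (i, j, tab z.2 l.joint i j) :: l) fun j => ?_
    exact ((htab l.joint i j).comp_measurable measurable_snd).map fun x => (i, j, x) :: l

theorem measurable_rowRegret
    (htab : ∀ past i j, DiscretelyMeasurable fun x => tab x past i j) (t : ℕ) :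
    Measurable fun z : (Ω × Ω) × X => A.rowRegret (tab z.2) z.1 t := by
  have key : ∀ i : Fin (m + 1), Measurable fun z : (Ω × Ω) × X =>
      ∑ s ∈ Finset.range t,
        tab z.2 (A.playBoth (tab z.2) z.1 s).joint i (A.colAction (tab z.2) z.1 s) := by
    intro i
    refine Finset.measurable_sum _ fun s _ => DiscretelyMeasurable.measurable ?_
    refine (A.discretelyMeasurable_playBoth htab s).bind (F := fun z l =>
      tab z.2 l.joint i (A.select n m z.1.2 l.flip)) fun l => ?_
    refine ((A.discretelyMeasurable_select l.flip).comp_measurable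
      (measurable_snd.comp measurable_fst)).bind (F := fun (z : (Ω × Ω) × X) j =>
      tab z.2 l.joint i j) fun j => ?_
    exact (htab l.joint i j).comp_measurable measurable_snd
  unfold rowRegret
  refine Measurable.div_const (Measurable.sub ?_ ?_) _
  · have := Finset.measurable_sup' Finset.univ_nonempty fun i _ => key i
    convert this using 1
    ext z
    simp [Finset.sup'_apply]
  · exact ((A.discretelyMeasurable_playBoth htab t).map History.payoff).measurable

/-- Hannan consistency concerns one fixed adversary, so Fubini is used twice: for the random table
and for the second player's tape. Measurability of the event is what makes this legitimate. -/
theorem ae_limsup_rowRegret_le {μ : Measure Ω} [IsProbabilityMeasure μ] {ν : Measure X}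
    [IsProbabilityMeasure ν] {ε : ℝ} (hA : A.HannanConsistent μ ε)
    (htab : ∀ past i j, DiscretelyMeasurable fun x => tab x past i j)
    (hmem : ∀ x past i j, tab x past i j ∈ Set.Icc (0 : ℝ) 1) :
    ∀ᵐ z ∂((μ.prod μ).prod ν),
      Filter.limsup (fun t => A.rowRegret (tab z.2) z.1 t) Filter.atTop ≤ ε := by
  have hmeas : MeasurableSet {z : (Ω × Ω) × X |
      Filter.limsup (fun t => A.rowRegret (tab z.2) z.1 t) Filter.atTop ≤ ε} :=
    measurableSet_le (.limsup fun t => A.measurable_rowRegret htab t) measurable_const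
  have h1 : ∀ x : X, ∀ᵐ ω ∂(μ.prod μ),
      Filter.limsup (fun t => A.rowRegret (tab x) ω t) Filter.atTop ≤ ε := by
    intro x
    have hx : MeasurableSet {ω : Ω × Ω |
        Filter.limsup (fun t => A.rowRegret (tab x) ω t) Filter.atTop ≤ ε} :=
      measurable_prodMk_right (y := x) hmeas
    have h2 : ∀ᵐ ω ∂(μ.prod μ),
        Filter.limsup (fun t => A.rowRegret (tab x) ω.swap t) Filter.atTop ≤ ε := by
      -- After the swap the outer variable is the second player's tape, which is held fixed.
      refine (Measure.ae_prod_iff_ae_ae (measurable_swap hx)).2 (.of_forall fun ω₂ => ?_)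
      filter_upwards [hA m n (A.adversary (tab x) ω₂) (A.adversaryPayoff (tab x) ω₂)
        fun past i => hmem x _ _ _] with ω₁ h
      have e := A.avgRegret_adversary (tab x) (ω₁, ω₂)
      simp only [e] at h
      exact h
    have := (Measure.measurePreserving_swap (μ := μ) (ν := μ)).quasiMeasurePreserving.ae h2
    simpa using this
  have h3 : ∀ᵐ z ∂(ν.prod (μ.prod μ)),
      Filter.limsup (fun t => A.rowRegret (tab z.1) z.2 t) Filter.atTop ≤ ε :=
    (Measure.ae_prod_iff_ae_ae (measurable_swap hmeas)).2 (.of_forall h1)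
  exact (Measure.measurePreserving_swap (μ := μ.prod μ) (ν := ν)).quasiMeasurePreserving.ae h3

theorem ae_limsup_rowRegret_flip_le {μ : Measure Ω} [IsProbabilityMeasure μ] {ν : Measure X}
    [IsProbabilityMeasure ν] {ε : ℝ} (hA : A.HannanConsistent μ ε)
    (htab : ∀ past i j, DiscretelyMeasurable fun x => tab x past i j)
    (hmem : ∀ x past i j, tab x past i j ∈ Set.Icc (0 : ℝ) 1) :
    ∀ᵐ z ∂((μ.prod μ).prod ν),
      Filter.limsup (fun t => A.rowRegret (tab z.2).flip z.1.swap t) Filter.atTop ≤ ε := by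
  have h := A.ae_limsup_rowRegret_le (ν := ν) (tab := fun x => (tab x).flip) hA
    (fun past j i => (htab (past.map Prod.swap) i j).map fun y => 1 - y)
    (fun x past j i => by
      have := hmem x (past.map Prod.swap) i j
      exact ⟨sub_nonneg.2 this.2, sub_le_self _ this.1⟩)
  exact ((Measure.measurePreserving_swap (μ := μ) (ν := μ)).prod
    (MeasurePreserving.id ν)).quasiMeasurePreserving.ae h

theorem ae_tendsto_count_playBoth {μ : Measure Ω} [IsProbabilityMeasure μ] {ν : Measure X}
    [IsProbabilityMeasure ν] (hA : A.GuaranteedExploration μ)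
    (htab : ∀ past i j, DiscretelyMeasurable fun x => tab x past i j)
    (hmem : ∀ x past i j, tab x past i j ∈ Set.Icc (0 : ℝ) 1) :
    ∀ᵐ z ∂((μ.prod μ).prod ν), ∀ p, Filter.Tendsto
      (fun t => (A.playBoth (tab z.2) z.1 t).joint.count p) Filter.atTop Filter.atTop := by
  have hmeas : MeasurableSet {z : (Ω × Ω) × X | ∀ p, Filter.Tendsto
      (fun t => (A.playBoth (tab z.2) z.1 t).joint.count p) Filter.atTop Filter.atTop} := by
    simp only [Filter.tendsto_atTop, Filter.eventually_atTop, Set.ofPred_forall, Set.ofPred_exists]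
    refine .iInter fun p => .iInter fun K => .iUnion fun t₀ => .iInter fun t => .iInter fun _ => ?_
    exact (A.discretelyMeasurable_playBoth htab t).measurableSet_preimage
      {l | K ≤ l.joint.count p}
  have h3 : ∀ᵐ z ∂(ν.prod (μ.prod μ)), ∀ p, Filter.Tendsto
      (fun t => (A.playBoth (tab z.1) z.2 t).joint.count p) Filter.atTop Filter.atTop := by
    refine (Measure.ae_prod_iff_ae_ae (measurable_swap hmeas)).2 (.of_forall fun x => ?_)
    filter_upwards [hA m n (tab x) (hmem x)] with ω h
    exact fun p => h p.1 p.2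
  exact (Measure.measurePreserving_swap (μ := μ.prod μ) (ν := ν)).quasiMeasurePreserving.ae h3

end Measurability

end SelectionAlgorithm

/-! ### Empirical frequencies and means -/

/-- The empirical frequencies of the first player's actions. -/
noncomputable def History.rowFreq {m n : ℕ} (l : History m n) (i : Fin (m + 1)) : ℝ :=
  ((l.map fun x => x.1).count i : ℝ) / l.length

/-- The empirical frequencies of the second player's actions. -/
noncomputable def History.colFreq {m n : ℕ} (l : History m n) (j : Fin (n + 1)) : ℝ :=
  ((l.map fun x => x.2.1).count j : ℝ) / l.length

theorem History.colFreq_flip {m n : ℕ} (l : History m n) : l.flip.colFreq = l.rowFreq := by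
  ext i
  simp [History.flip, History.colFreq, History.rowFreq, Function.comp_def]

theorem List.count_div_length_mem_stdSimplex {α : Type*} [Fintype α] [DecidableEq α] {l : List α}
    (hl : l ≠ []) : (fun a => (l.count a : ℝ) / l.length) ∈ stdSimplex ℝ α := by
  refine ⟨fun a => by positivity, ?_⟩
  have h : (l.length : ℝ) ≠ 0 := by simpa using hl
  rw [← Finset.sum_div, div_eq_one_iff_eq h]
  have := Multiset.sum_count_eq_card (s := Finset.univ) (m := (l : Multiset α))
    fun _ _ => Finset.mem_univ _
  simp only [Multiset.coe_count, Multiset.coe_card] at this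
  exact_mod_cast this

theorem History.rowFreq_mem_stdSimplex {m n : ℕ} {l : History m n} (hl : l ≠ []) :
    l.rowFreq ∈ stdSimplex ℝ (Fin (m + 1)) := by
  have := List.count_div_length_mem_stdSimplex (l := l.map fun x => x.1) (by simpa using hl)
  simp only [List.length_map] at this
  exact this

theorem History.colFreq_mem_stdSimplex {m n : ℕ} {l : History m n} (hl : l ≠ []) :
    l.colFreq ∈ stdSimplex ℝ (Fin (n + 1)) := by
  have := List.count_div_length_mem_stdSimplex (l := l.map fun x => x.2.1) (by simpa using hl)
  simp only [List.length_map] at this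
  exact this

theorem SMGame.meanValue_flip {m n : ℕ} {l : History m n} (hl : l ≠ []) :
    SMGame.meanValue l.flip = 1 - SMGame.meanValue l := by
  have h : (l.length : ℝ) ≠ 0 := by simpa using hl
  have h2 := l.payoff_flip
  have h3 : l.flip.length = l.length := by simp [History.flip]
  unfold SMGame.meanValue
  unfold History.payoff at h2
  rw [h2, h3, sub_div, div_self h]

theorem SMGame.meanValue_mem_Icc {m n : ℕ} {l : History m n}
    (hl : ∀ x ∈ l, x.2.2 ∈ Set.Icc (0 : ℝ) 1) : SMGame.meanValue l ∈ Set.Icc (0 : ℝ) 1 := by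
  unfold SMGame.meanValue
  have h0 : 0 ≤ (l.map fun x => x.2.2).sum :=
    List.sum_nonneg (by simpa using fun x a b h => (hl _ h).1)
  have h1 : (l.map fun x => x.2.2).sum ≤ l.length := by
    have := List.sum_le_card_nsmul (l.map fun x => x.2.2) 1
      (by simpa using fun x a b h => (hl _ h).2)
    simpa using this
  exact ⟨by positivity, div_le_one_of_le₀ h1 (by positivity)⟩

/-- The payoff tables of a game in which the `k`-th play of the joint action `p` pays `ret p k`. -/
def visitTable {m n : ℕ} (ret : Fin (m + 1) × Fin (n + 1) → ℕ → ℝ) : PayoffTable m n :=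
  fun past i j => ret (i, j) (past.count (i, j))

theorem visitTable_flip {m n : ℕ} (ret : Fin (m + 1) × Fin (n + 1) → ℕ → ℝ) :
    (visitTable ret).flip = visitTable fun p k => 1 - ret p.swap k := by
  ext past j i
  simp [PayoffTable.flip, visitTable, List.count_map_swap]

/-! ### From small regret to near-optimal empirical frequencies -/

namespace SelectionAlgorithm

variable {Ω : Type*} [MeasurableSpace Ω] (A : SelectionAlgorithm Ω) {m n : ℕ}

theorem playBoth_ne_nil (tab : PayoffTable m n) (ω : Ω × Ω) {t : ℕ} (ht : 0 < t) :
    A.playBoth tab ω t ≠ [] := by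
  rw [← List.length_pos_iff_ne_nil, length_playBoth]
  exact ht

theorem playBoth_payoff_mem_Icc {tab : PayoffTable m n}
    (hmem : ∀ past i j, tab past i j ∈ Set.Icc (0 : ℝ) 1) (ω : Ω × Ω) (t : ℕ) :
    ∀ x ∈ A.playBoth tab ω t, x.2.2 ∈ Set.Icc (0 : ℝ) 1 := by
  induction t with
  | zero => intro x hx; cases hx
  | succ t ih =>
    intro x hx
    rw [playBoth_succ] at hx
    rcases List.mem_cons.1 hx with rfl | hx
    · exact hmem _ _ _
    · exact ih x hx

theorem sum_range_colAction (tab : PayoffTable m n) (ω : Ω × Ω) (f : Fin (n + 1) → ℝ) (t : ℕ) :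
    ∑ s ∈ Finset.range t, f (A.colAction tab ω s) =
      t * ∑ j, (A.playBoth tab ω t).colFreq j * f j := by
  have key : ∑ s ∈ Finset.range t, f (A.colAction tab ω s) =
      ∑ j, (((A.playBoth tab ω t).map fun x => x.2.1).count j : ℝ) * f j := by
    induction t with
    | zero => simp [playBoth]
    | succ t ih =>
      rw [Finset.sum_range_succ, ih, playBoth_succ]
      simp [List.count_cons, add_mul, Finset.sum_add_distrib]
  rw [key, Finset.mul_sum]
  refine Finset.sum_congr rfl fun j _ => ?_
  rw [History.colFreq, length_playBoth]
  rcases Nat.eq_zero_or_pos t with rfl | ht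
  · simp [playBoth]
  · field_simp

/-- Boundedness above is needed to draw conclusions from the `limsup` in ℝ. -/
theorem rowRegret_le_one {tab : PayoffTable m n}
    (hmem : ∀ past i j, tab past i j ∈ Set.Icc (0 : ℝ) 1) (ω : Ω × Ω) (t : ℕ) :
    A.rowRegret tab ω t ≤ 1 := by
  unfold rowRegret
  refine div_le_one_of_le₀ ?_ (by positivity)
  have h0 : 0 ≤ (A.playBoth tab ω t).payoff :=
    List.sum_nonneg (by simpa using fun x a b h => (A.playBoth_payoff_mem_Icc hmem ω t _ h).1)
  refine (sub_le_self _ h0).trans (Finset.sup'_le _ _ fun i _ => ?_)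
  simpa using Finset.sum_le_card_nsmul (Finset.range t) _ 1 fun s _ =>
    (hmem (A.playBoth tab ω s).joint i (A.colAction tab ω s)).2

theorem sum_le_mul_rowRegret (tab : PayoffTable m n) (ω : Ω × Ω) {t : ℕ} (ht : 0 < t)
    (i : Fin (m + 1)) :
    ∑ s ∈ Finset.range t, tab (A.playBoth tab ω s).joint i (A.colAction tab ω s) ≤
      t * (SMGame.meanValue (A.playBoth tab ω t) + A.rowRegret tab ω t) := by
  have ht' : (t : ℝ) ≠ 0 := by positivity
  have h := Finset.le_sup' (fun i : Fin (m + 1) =>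
    ∑ s ∈ Finset.range t, tab (A.playBoth tab ω s).joint i (A.colAction tab ω s))
    (Finset.mem_univ i)
  refine h.trans (le_of_eq ?_)
  unfold rowRegret SMGame.meanValue History.payoff
  rw [length_playBoth]
  field_simp
  ring

/-- If the values of all joint actions are eventually at least `V - C` and the average regret of
the first player is at most `ε`, then no action of the first player is much better against the
empirical frequencies of the second player than the average payoff. -/
theorem eventually_sum_colFreq_le {ret : Fin (m + 1) × Fin (n + 1) → ℕ → ℝ}
    (hret : ∀ p k, ret p k ∈ Set.Icc (0 : ℝ) 1) {V : Fin (m + 1) × Fin (n + 1) → ℝ}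
    (hV : ∀ p, V p ≤ 1) {C ε : ℝ} (hC : 0 ≤ C)
    (hconv : ∀ η > 0, ∀ p, ∀ᶠ k in Filter.atTop, V p - (C + η) ≤ ret p k) {ω : Ω × Ω}
    (hcount : ∀ p, Filter.Tendsto (fun t => (A.playBoth (visitTable ret) ω t).joint.count p)
      Filter.atTop Filter.atTop)
    (hreg : Filter.limsup (fun t => A.rowRegret (visitTable ret) ω t) Filter.atTop ≤ ε)
    {η : ℝ} (hη : 0 < η) :
    ∀ᶠ t in Filter.atTop, ∀ i, ∑ j, (A.playBoth (visitTable ret) ω t).colFreq j * V (i, j) ≤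
      SMGame.meanValue (A.playBoth (visitTable ret) ω t) + (C + ε + η) := by
  have hη3 : 0 < η / 3 := by positivity
  have hmem : ∀ past i j, visitTable ret past i j ∈ Set.Icc (0 : ℝ) 1 :=
    fun past i j => hret _ _
  have h1 : ∀ᶠ t in Filter.atTop, A.rowRegret (visitTable ret) ω t < ε + η / 3 :=
    Filter.eventually_lt_of_limsup_lt (hreg.trans_lt (by linarith))
      (Filter.isBoundedUnder_of ⟨1, fun t => A.rowRegret_le_one hmem ω t⟩)
  -- Exploration enters here: all counts diverge, so the bound also holds for entries the players do
  -- not choose in round `s`, and regret compares with exactly such entries.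
  have h2 : ∀ᶠ s in Filter.atTop, ∀ p,
      V p - (C + η / 3) ≤ ret p ((A.playBoth (visitTable ret) ω s).joint.count p) :=
    Filter.eventually_all.2 fun p => (hcount p).eventually (hconv _ hη3 p)
  obtain ⟨s₀, hs₀⟩ := Filter.eventually_atTop.1 h2
  have h3 : ∀ᶠ t : ℕ in Filter.atTop, (s₀ : ℝ) / (η / 3) ≤ t :=
    tendsto_natCast_atTop_atTop.eventually_ge_atTop _
  filter_upwards [h1, h3, Filter.eventually_gt_atTop 0] with t ht1 ht3 ht0 i
  have ht : (0 : ℝ) < t := by exact_mod_cast ht0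
  -- Each of the first `s₀` rounds costs at most 1, as values and payoffs lie in [0, 1]; by `ht3`
  -- their total is at most `t * (η / 3)`.
  have hpt : ∀ s ∈ Finset.range t, V (i, A.colAction (visitTable ret) ω s) ≤
      visitTable ret (A.playBoth (visitTable ret) ω s).joint i (A.colAction (visitTable ret) ω s) +
        (C + η / 3) + if s < s₀ then 1 else 0 := by
    intro s _
    split_ifs with hs
    · have := hV (i, A.colAction (visitTable ret) ω s)
      have := (hmem (A.playBoth (visitTable ret) ω s).joint i
        (A.colAction (visitTable ret) ω s)).1
      linarith
    · have := hs₀ s (not_lt.1 hs) (i, A.colAction (visitTable ret) ω s)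
      unfold visitTable at this ⊢
      linarith
  have hsum := Finset.sum_le_sum hpt
  rw [A.sum_range_colAction (visitTable ret) ω (fun j => V (i, j)), Finset.sum_add_distrib,
    Finset.sum_add_distrib, Finset.sum_const, Finset.card_range, nsmul_eq_mul] at hsum
  have hs : ∑ s ∈ Finset.range t, (if s < s₀ then (1 : ℝ) else 0) ≤ s₀ := by
    rw [Finset.sum_boole]
    have : ((Finset.range t).filter (· < s₀)).card ≤ (Finset.range s₀).card :=
      Finset.card_le_card fun s hs => by simpa using (Finset.mem_filter.1 hs).2
    rw [Finset.card_range] at this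
    exact_mod_cast this
  have hr := A.sum_le_mul_rowRegret (visitTable ret) ω ht0 i
  rw [div_le_iff₀ hη3] at ht3
  have hr2 := mul_le_mul_of_nonneg_left ht1.le ht.le
  refine le_of_mul_le_mul_left ?_ ht
  linarith

/-- The counterpart of `eventually_sum_colFreq_le` for the second player. -/
theorem eventually_le_sum_rowFreq {ret : Fin (m + 1) × Fin (n + 1) → ℕ → ℝ}
    (hret : ∀ p k, ret p k ∈ Set.Icc (0 : ℝ) 1) {V : Fin (m + 1) × Fin (n + 1) → ℝ}
    (hV : ∀ p, 0 ≤ V p) {C ε : ℝ} (hC : 0 ≤ C)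
    (hconv : ∀ η > 0, ∀ p, ∀ᶠ k in Filter.atTop, ret p k ≤ V p + (C + η)) {ω : Ω × Ω}
    (hcount : ∀ p, Filter.Tendsto (fun t => (A.playBoth (visitTable ret) ω t).joint.count p)
      Filter.atTop Filter.atTop)
    (hreg : Filter.limsup (fun t => A.rowRegret (visitTable ret).flip ω.swap t) Filter.atTop ≤ ε)
    {η : ℝ} (hη : 0 < η) :
    ∀ᶠ t in Filter.atTop, ∀ j, SMGame.meanValue (A.playBoth (visitTable ret) ω t) - (C + ε + η) ≤
      ∑ i, (A.playBoth (visitTable ret) ω t).rowFreq i * V (i, j) := by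
  have hplay := A.playBoth_flip (visitTable ret) ω
  rw [visitTable_flip] at hreg hplay
  -- The second player's view: roles swapped, payoffs and values replaced by their complements to 1.
  have h := A.eventually_sum_colFreq_le (ret := fun p k => 1 - ret p.swap k)
    (V := fun p => 1 - V p.swap) (C := C) (ω := ω.swap)
    (fun p k => ⟨sub_nonneg.2 (hret _ _).2, sub_le_self _ (hret _ _).1⟩)
    (fun p => sub_le_self _ (hV _)) hC
    (fun η hη p => (hconv η hη p.swap).mono fun k hk => by linarith)
    (fun p => by
      simp only [hplay, History.joint_flip, List.count_map_swap]
      exact hcount p.swap) hreg hη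
  filter_upwards [h, Filter.eventually_gt_atTop 0] with t ht ht0 j
  have hne := A.playBoth_ne_nil (visitTable ret) ω ht0
  have := ht j
  rw [hplay, History.colFreq_flip, SMGame.meanValue_flip hne] at this
  simp only [Prod.swap_prod_mk, mul_sub, mul_one, Finset.sum_sub_distrib,
    (History.rowFreq_mem_stdSimplex hne).2] at this
  linarith

end SelectionAlgorithm

/-! ### Matrix games and weak duality -/

section MatrixGame

variable {m n : ℕ}

/-- The least payoff that the second player can guarantee in a matrix game. -/
noncomputable def upperValue (V : Fin (m + 1) × Fin (n + 1) → ℝ) : ℝ :=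
  ⨅ f : stdSimplex ℝ (Fin (n + 1)),
    Finset.univ.sup' Finset.univ_nonempty fun i : Fin (m + 1) => ∑ j, f.1 j * V (i, j)

theorem upperValue_le {V : Fin (m + 1) × Fin (n + 1) → ℝ} (hV : ∀ p, 0 ≤ V p)
    {f : Fin (n + 1) → ℝ} (hf : f ∈ stdSimplex ℝ (Fin (n + 1))) {x : ℝ}
    (h : ∀ i, ∑ j, f j * V (i, j) ≤ x) : upperValue V ≤ x := by
  refine (ciInf_le ⟨0, ?_⟩ (⟨f, hf⟩ : stdSimplex ℝ (Fin (n + 1)))).trans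
    (Finset.sup'_le _ _ fun i _ => h i)
  rintro _ ⟨g, rfl⟩
  exact (Finset.sum_nonneg fun j _ => mul_nonneg (g.2.1 j) (hV (0, j))).trans
    (Finset.le_sup' (fun i : Fin (m + 1) => ∑ j, g.1 j * V (i, j)) (Finset.mem_univ 0))

/-- Separates the two sources of gain from a deviation: `x` bounds what the action at the root earns
when subgames are worth `V`, and `K` what deviating inside the subgames adds. -/
theorem sum_mul_mul_le {a : Fin (m + 1) → ℝ} {f : Fin (n + 1) → ℝ}
    (ha : a ∈ stdSimplex ℝ (Fin (m + 1))) (hf : f ∈ stdSimplex ℝ (Fin (n + 1)))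
    {V U : Fin (m + 1) × Fin (n + 1) → ℝ} {x K : ℝ} (hx : ∀ i, ∑ j, f j * V (i, j) ≤ x)
    (hU : ∀ p, U p ≤ V p + K) : ∑ p, a p.1 * f p.2 * U p ≤ x + K := by
  rw [Fintype.sum_prod_type]
  calc ∑ i, ∑ j, a i * f j * U (i, j) ≤ ∑ i, a i * (x + K) := by
        refine Finset.sum_le_sum fun i _ => ?_
        simp only [mul_assoc, ← Finset.mul_sum]
        refine mul_le_mul_of_nonneg_left ?_ (ha.1 i)
        calc ∑ j, f j * U (i, j) ≤ ∑ j, f j * (V (i, j) + K) :=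
              Finset.sum_le_sum fun j _ => mul_le_mul_of_nonneg_left (hU _) (hf.1 j)
          _ = ∑ j, f j * V (i, j) + K := by
              simp only [mul_add, Finset.sum_add_distrib, ← Finset.sum_mul, hf.2, one_mul]
          _ ≤ x + K := by linarith [hx i]
    _ = x + K := by rw [← Finset.sum_mul, ha.2, one_mul]

theorem le_sum_mul_mul {a : Fin (m + 1) → ℝ} {f : Fin (n + 1) → ℝ}
    (ha : a ∈ stdSimplex ℝ (Fin (m + 1))) (hf : f ∈ stdSimplex ℝ (Fin (n + 1)))
    {V U : Fin (m + 1) × Fin (n + 1) → ℝ} {x K : ℝ} (hx : ∀ j, x ≤ ∑ i, a i * V (i, j))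
    (hU : ∀ p, V p - K ≤ U p) : x - K ≤ ∑ p, a p.1 * f p.2 * U p := by
  have h := sum_mul_mul_le hf ha (V := fun p => -V p.swap) (U := fun p => -U p.swap)
    (x := -x) (K := K) (fun j => by simpa using hx j) (fun p => by linarith [hU p.swap])
  have e : ∑ p : Fin (n + 1) × Fin (m + 1), f p.1 * a p.2 * -U p.swap =
      -∑ p, a p.1 * f p.2 * U p := by
    rw [← Finset.sum_neg_distrib]
    exact Fintype.sum_equiv (Equiv.prodComm _ _) _ _ fun p => by
      simp only [Equiv.prodComm_apply, Prod.fst_swap, Prod.snd_swap]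
      ring
  linarith

/-- Weak duality. The minimax theorem is not needed, since the empirical frequencies of both players
nearly attain the same mean payoff. -/
theorem le_upperValue {V : Fin (m + 1) × Fin (n + 1) → ℝ} {a : Fin (m + 1) → ℝ}
    (ha : a ∈ stdSimplex ℝ (Fin (m + 1))) {x : ℝ} (h : ∀ j, x ≤ ∑ i, a i * V (i, j)) :
    x ≤ upperValue V := by
  have : Nonempty (stdSimplex ℝ (Fin (n + 1))) := ⟨⟨_, single_mem_stdSimplex ℝ 0⟩⟩
  refine le_ciInf fun f => ?_
  have h1 := le_sum_mul_mul ha f.2 (U := V) (K := 0) h fun p => by simp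
  have h2 := sum_mul_mul_le ha f.2 (V := V) (U := V) (K := 0)
    (x := Finset.univ.sup' Finset.univ_nonempty fun i : Fin (m + 1) => ∑ j, f.1 j * V (i, j))
    (fun i => Finset.le_sup' (fun i : Fin (m + 1) => ∑ j, f.1 j * V (i, j)) (Finset.mem_univ i))
    fun p => by simp
  linarith

end MatrixGame

/-! ### Game values and the search as nested repeated games -/

namespace SMGame

/-- The value of a game, computed by backward induction. -/
noncomputable def value : SMGame → ℝ
  | terminal u => u
  | node _ _ c => upperValue fun p => value (c p)

theorem value_mem_Icc (G : SMGame) : G.value ∈ Set.Icc (0 : ℝ) 1 := by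
  induction G with
  | terminal u => exact u.2
  | node m n c ih =>
    refine ⟨le_upperValue (single_mem_stdSimplex ℝ 0) fun j =>
      Finset.sum_nonneg fun i _ => mul_nonneg ((single_mem_stdSimplex ℝ 0).1 i) (ih _).1,
      upperValue_le (fun p => (ih p).1) (single_mem_stdSimplex ℝ 0) fun i => ?_⟩
    calc _ ≤ ∑ j, (Pi.single 0 1 : Fin (n + 1) → ℝ) j * 1 :=
          Finset.sum_le_sum fun j _ =>
            mul_le_mul_of_nonneg_left (ih _).2 ((single_mem_stdSimplex ℝ 0).1 j)
      _ = 1 := by simp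

theorem IsNash.mono {G : SMGame} {η η' : ℝ} {σ₁ : G.Strat₁} {σ₂ : G.Strat₂}
    (h : G.IsNash η σ₁ σ₂) (hη : η ≤ η') : G.IsNash η' σ₁ σ₂ :=
  ⟨h.1, h.2.1, fun σ hσ => (h.2.2.1 σ hσ).trans hη, fun σ hσ => (h.2.2.2 σ hσ).trans hη⟩

theorem IsSubgamePerfect.mono {η η' : ℝ} (hη : η ≤ η') :
    ∀ {G : SMGame} {σ₁ : G.Strat₁} {σ₂ : G.Strat₂},
      IsSubgamePerfect η G σ₁ σ₂ → IsSubgamePerfect η' G σ₁ σ₂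
  | terminal _, _, _, h => IsNash.mono h hη
  | node _ _ _, _, _, h => ⟨IsNash.mono h.1 hη, fun p => (h.2 p).mono hη⟩

variable {Ω : Type*} [MeasurableSpace Ω] (A : SelectionAlgorithm Ω)

/-- The value returned by the `(t + 1)`-st simulation. -/
noncomputable def returned (G : SMGame) (τ : G.Tapes Ω) (t : ℕ) : ℝ :=
  (G.simulate A τ (G.search A τ t)).2

section Node

variable {m n : ℕ} (c : Fin (m + 1) × Fin (n + 1) → SMGame)

/-- The payoff tables that the players face at the root. -/
noncomputable def rootTable (τ : ∀ p, (c p).Tapes Ω) : PayoffTable m n :=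
  visitTable fun p => (c p).returned A (τ p)

/-- The play at the root. -/
noncomputable def rootPlay (τ : (node m n c).Tapes Ω) (t : ℕ) : History m n :=
  A.playBoth (rootTable A c τ.2) τ.1 t

/-- Each child runs on its own clock, the number of plays of its joint action, and is otherwise
unaffected by the rest of the tree. -/
theorem search_node (τ : (node m n c).Tapes Ω) (t : ℕ) :
    (node m n c).search A τ t = (rootPlay A c τ t, fun p =>
      (c p).search A (τ.2 p) ((rootPlay A c τ t).joint.count p)) := by
  induction t with
  | zero => rfl
  | succ t ih =>
    rw [search, ih]
    refine Prod.ext rfl (funext fun p => ?_)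
    set q := (A.rowAction (rootTable A c τ.2) τ.1 t, A.colAction (rootTable A c τ.2) τ.1 t)
      with hq
    have hcount : (rootPlay A c τ (t + 1)).joint.count p =
        (rootPlay A c τ t).joint.count p + if q = p then 1 else 0 := by
      unfold rootPlay
      rw [A.playBoth_succ, History.joint, List.map_cons, List.count_cons]
      simp only [← hq, beq_iff_eq]
      rfl
    change Function.update (fun p => (c p).search A (τ.2 p) ((rootPlay A c τ t).joint.count p)) q
      ((c q).search A (τ.2 q) ((rootPlay A c τ t).joint.count q + 1)) p =
        (c p).search A (τ.2 p) ((rootPlay A c τ (t + 1)).joint.count p)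
    rw [hcount]
    by_cases hp : q = p
    · subst hp
      rw [Function.update_self, if_pos rfl]
    · rw [Function.update_of_ne (Ne.symm hp), if_neg hp]
      rfl

/-- The index is `t + 1` because the mean returned already includes the current value. -/
theorem returned_node (τ : (node m n c).Tapes Ω) (t : ℕ) :
    (node m n c).returned A τ t = meanValue (rootPlay A c τ (t + 1)) := by
  rw [returned, search_node]
  rfl

end Node

theorem returned_mem_Icc (G : SMGame) :
    ∀ (τ : G.Tapes Ω) (t : ℕ), G.returned A τ t ∈ Set.Icc (0 : ℝ) 1 := by
  induction G with
  | terminal u => exact fun _ _ => u.2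
  | node m n c ih =>
    intro τ t
    rw [returned_node]
    exact meanValue_mem_Icc (A.playBoth_payoff_mem_Icc (fun _ _ _ => ih _ _ _) _ _)

theorem discretelyMeasurable_simulate (G : SMGame) :
    ∀ s : G.SearchState, DiscretelyMeasurable fun τ : G.Tapes Ω => G.simulate A τ s := by
  induction G with
  | terminal u => exact fun s => .const (s, (u : ℝ))
  | node m n c ih =>
    intro s
    change DiscretelyMeasurable fun τ : (Ω × Ω) × (∀ p, Tapes Ω (c p)) =>
      (node m n c).simulate A τ s
    refine ((A.discretelyMeasurable_select s.1).comp_measurable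
      (measurable_fst.comp measurable_fst)).bind
      (F := fun (τ : (Ω × Ω) × (∀ p, Tapes Ω (c p))) i =>
        let j := A.select n m τ.1.2 s.1.flip
        let r := simulate A (c (i, j)) (τ.2 (i, j)) (s.2 (i, j))
        let l : History m n := (i, j, r.2) :: s.1
        (((l, Function.update s.2 (i, j) r.1), meanValue l) :
          (node m n c).SearchState × ℝ)) fun i => ?_
    refine ((A.discretelyMeasurable_select s.1.flip).comp_measurable
      (measurable_snd.comp measurable_fst)).bind
      (F := fun (τ : (Ω × Ω) × (∀ p, Tapes Ω (c p))) j =>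
        let r := simulate A (c (i, j)) (τ.2 (i, j)) (s.2 (i, j))
        let l : History m n := (i, j, r.2) :: s.1
        (((l, Function.update s.2 (i, j) r.1), meanValue l) :
          (node m n c).SearchState × ℝ)) fun j => ?_
    exact ((ih (i, j) (s.2 (i, j))).comp_measurable
      ((measurable_pi_apply (i, j)).comp measurable_snd)).map fun r =>
        let l : History m n := (i, j, r.2) :: s.1
        (((l, Function.update s.2 (i, j) r.1), meanValue l) : (node m n c).SearchState × ℝ)

theorem discretelyMeasurable_search (G : SMGame) (t : ℕ) :
    DiscretelyMeasurable fun τ : G.Tapes Ω => G.search A τ t := by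
  induction t with
  | zero => exact .const _
  | succ t ih =>
    exact ih.bind (F := fun τ s => (G.simulate A τ s).1) fun s =>
      (discretelyMeasurable_simulate A G s).map Prod.fst

theorem discretelyMeasurable_returned (G : SMGame) (t : ℕ) :
    DiscretelyMeasurable fun τ : G.Tapes Ω => G.returned A τ t :=
  (discretelyMeasurable_search A G t).bind (F := fun τ s => (G.simulate A τ s).2) fun s =>
    (discretelyMeasurable_simulate A G s).map Prod.snd

instance isProbabilityMeasure_tapeMeasure (μ : Measure Ω) [IsProbabilityMeasure μ] (G : SMGame) :
    IsProbabilityMeasure (G.tapeMeasure μ) := by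
  induction G with
  | terminal u => exact Measure.dirac.isProbabilityMeasure (α := PUnit)
  | node m n c ih =>
    exact inferInstanceAs (IsProbabilityMeasure
      ((μ.prod μ).prod (Measure.pi fun p => tapeMeasure μ (c p))))

/-! ### Error bounds by induction on the tree -/

/-- The state `s` of the search and the last returned value `x` are within `η` of the asymptotic
guarantees for `ε`-Hannan consistent selection. -/
structure IsAccurate (G : SMGame) (ε η : ℝ) (s : G.SearchState) (x : ℝ) : Prop where
  le_value : x ≤ G.value + (G.depth * ε + η)
  value_le : G.value - (G.depth * ε + η) ≤ x
  isStrat₁ : G.IsStrat₁ (G.empirical₁ s)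
  isStrat₂ : G.IsStrat₂ (G.empirical₂ s)
  utility_le : ∀ σ, G.IsStrat₁ σ →
    G.utility σ (G.empirical₂ s) ≤ G.value + (G.depth * (G.depth + 1) * ε + η)
  le_utility : ∀ σ, G.IsStrat₂ σ →
    G.value - (G.depth * (G.depth + 1) * ε + η) ≤ G.utility (G.empirical₁ s) σ
  isSubgamePerfect :
    G.IsSubgamePerfect (2 * G.depth ^ 2 * ε + η) (G.empirical₁ s) (G.empirical₂ s)

/-- The search meets the asymptotic guarantees for `ε`-Hannan consistent selection. -/
def SearchConverges (G : SMGame) (ε : ℝ) (τ : G.Tapes Ω) : Prop :=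
  ∀ η > 0, ∀ᶠ t in Filter.atTop, G.IsAccurate ε η (G.search A τ t) (G.returned A τ t)

theorem searchConverges_terminal (u : Set.Icc (0 : ℝ) 1) (ε : ℝ) (τ : (terminal u).Tapes Ω) :
    (terminal u).SearchConverges A ε τ := by
  refine fun η hη => .of_forall fun t => ?_
  constructor
  · simp [depth, value, returned, simulate, hη.le]
  · simp [depth, value, returned, simulate, hη.le]
  · trivial
  · trivial
  · intro σ _
    simp [depth, value, utility, hη.le]
  · intro σ _
    simp [depth, value, utility, hη.le]
  · refine ⟨trivial, trivial, fun σ _ => ?_, fun σ _ => ?_⟩ <;> simp [depth, utility, hη.le]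

/-- Bookkeeping in units of ε, with D the largest depth of a child. The mean differs from the value
by at most D+1. A deviation exceeds the mean by at most D+1 at the root plus D(D+1) in the subgames,
that is (D+1)². Relative to the value this is (D+1) + (D+1)² = (D+1)(D+2), which reproduces the
inductive bound. -/
theorem searchConverges_node {m n : ℕ} (c : Fin (m + 1) × Fin (n + 1) → SMGame) {ε : ℝ}
    (hε : 0 ≤ ε) (τ : (node m n c).Tapes Ω)
    (hc : ∀ p, (c p).SearchConverges A ε (τ.2 p))
    (hcount : ∀ p, Filter.Tendsto (fun t => (rootPlay A c τ t).joint.count p)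
      Filter.atTop Filter.atTop)
    (hreg₁ : Filter.limsup (fun t => A.rowRegret (rootTable A c τ.2) τ.1 t) Filter.atTop ≤ ε)
    (hreg₂ : Filter.limsup (fun t => A.rowRegret (rootTable A c τ.2).flip τ.1.swap t)
      Filter.atTop ≤ ε) :
    (node m n c).SearchConverges A ε τ := by
  intro η hη
  have hη4 : 0 < η / 4 := by positivity
  obtain ⟨D, hD⟩ : ∃ D : ℕ, D = Finset.univ.sup fun p => (c p).depth := ⟨_, rfl⟩
  have hdepth : ((node m n c).depth : ℝ) = D + 1 := by
    rw [depth, ← hD]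
    push_cast
    rfl
  have hle : ∀ p, ((c p).depth : ℝ) ≤ D := fun p => by
    rw [hD]
    exact_mod_cast Finset.le_sup (f := fun p => (c p).depth) (Finset.mem_univ p)
  have hle1 : ∀ p, ((c p).depth : ℝ) * ε ≤ D * ε := fun p =>
    mul_le_mul_of_nonneg_right (hle p) hε
  have hle2 : ∀ p, ((c p).depth : ℝ) * ((c p).depth + 1) * ε ≤ D * (D + 1) * ε := fun p => by
    have := hle p
    gcongr
  have hle3 : ∀ p, 2 * ((c p).depth : ℝ) ^ 2 * ε ≤ 2 * (D + 1) ^ 2 * ε := fun p => by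
    have := hle p
    gcongr
    linarith
  have e₁ := A.eventually_sum_colFreq_le (ret := fun p => (c p).returned A (τ.2 p))
    (fun p k => returned_mem_Icc A _ _ _) (V := fun p => (c p).value)
    (fun p => (value_mem_Icc _).2) (C := D * ε) (by positivity)
    (fun η hη p => (hc p η hη).mono fun k hk => by linarith [hk.value_le, hle1 p])
    hcount hreg₁ hη4
  have e₂ := A.eventually_le_sum_rowFreq (ret := fun p => (c p).returned A (τ.2 p))
    (fun p k => returned_mem_Icc A _ _ _) (V := fun p => (c p).value)
    (fun p => (value_mem_Icc _).1) (C := D * ε) (by positivity)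
    (fun η hη p => (hc p η hη).mono fun k hk => by linarith [hk.le_value, hle1 p])
    hcount hreg₂ hη4
  change ∀ᶠ t in Filter.atTop, ∀ i, ∑ j, (rootPlay A c τ t).colFreq j * (c (i, j)).value ≤
    meanValue (rootPlay A c τ t) + (D * ε + ε + η / 4) at e₁
  change ∀ᶠ t in Filter.atTop, ∀ j, meanValue (rootPlay A c τ t) - (D * ε + ε + η / 4) ≤
    ∑ i, (rootPlay A c τ t).rowFreq i * (c (i, j)).value at e₂
  -- On an empty history the frequencies are 0 / 0 = 0, not a distribution.
  have e₃ : ∀ᶠ t in Filter.atTop, rootPlay A c τ t ≠ [] :=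
    (Filter.eventually_gt_atTop 0).mono fun t ht => A.playBoth_ne_nil _ _ ht
  have e₄ : ∀ᶠ t in Filter.atTop,
      meanValue (rootPlay A c τ t) ≤ (node m n c).value + (D * ε + ε + η / 4) ∧
      (node m n c).value - (D * ε + ε + η / 4) ≤ meanValue (rootPlay A c τ t) := by
    filter_upwards [e₁, e₂, e₃] with t h₁ h₂ h₃
    have h₄ := upperValue_le (fun p => (value_mem_Icc _).1) (History.colFreq_mem_stdSimplex h₃) h₁
    have h₅ := le_upperValue (V := fun p => (c p).value) (History.rowFreq_mem_stdSimplex h₃) h₂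
    rw [value]
    exact ⟨by linarith, by linarith⟩
  have e₅ : ∀ᶠ t in Filter.atTop, ∀ p, (c p).IsAccurate ε (η / 4)
      ((c p).search A (τ.2 p) ((rootPlay A c τ t).joint.count p))
      ((c p).returned A (τ.2 p) ((rootPlay A c τ t).joint.count p)) :=
    Filter.eventually_all.2 fun p => (hcount p).eventually (hc p _ hη4)
  -- `e₄` is needed at `t` for the strategies and at `t + 1` for the returned value.
  filter_upwards [e₁, e₂, e₃, e₄, (Filter.tendsto_add_atTop_nat 1).eventually e₄, e₅]
    with t h₁ h₂ h₃ h₄ h₄' h₅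
  rw [returned_node, search_node]
  set l := rootPlay A c τ t
  have hrow := History.rowFreq_mem_stdSimplex h₃
  have hcol := History.colFreq_mem_stdSimplex h₃
  set s : (node m n c).SearchState := (l, fun p => (c p).search A (τ.2 p) (l.joint.count p))
  have hs₁ : (node m n c).IsStrat₁ ((node m n c).empirical₁ s) := ⟨hrow, fun p => (h₅ p).isStrat₁⟩
  have hs₂ : (node m n c).IsStrat₂ ((node m n c).empirical₂ s) := ⟨hcol, fun p => (h₅ p).isStrat₂⟩
  have hu₁ : ∀ σ, (node m n c).IsStrat₁ σ → (node m n c).utility σ ((node m n c).empirical₂ s) ≤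
      meanValue l + (D * ε + ε + η / 4) + (D * (D + 1) * ε + η / 4) := fun σ hσ =>
    sum_mul_mul_le hσ.1 hcol (V := fun p => (c p).value) h₁ fun p =>
      ((h₅ p).utility_le (σ.2 p) (hσ.2 p)).trans (by linarith [hle2 p])
  have hu₂ : ∀ σ, (node m n c).IsStrat₂ σ →
      meanValue l - (D * ε + ε + η / 4) - (D * (D + 1) * ε + η / 4) ≤
        (node m n c).utility ((node m n c).empirical₁ s) σ := fun σ hσ =>
    le_sum_mul_mul hrow hσ.1 (V := fun p => (c p).value) h₂ fun p =>
      le_trans (by linarith [hle2 p]) ((h₅ p).le_utility (σ.2 p) (hσ.2 p))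
  constructor
  · rw [hdepth]
    linarith [h₄'.1]
  · rw [hdepth]
    linarith [h₄'.2]
  · exact hs₁
  · exact hs₂
  · intro σ hσ
    rw [hdepth]
    linarith [hu₁ σ hσ, h₄.1]
  · intro σ hσ
    rw [hdepth]
    linarith [hu₂ σ hσ, h₄.2]
  · rw [hdepth]
    refine ⟨⟨hs₁, hs₂, fun σ hσ => ?_, fun σ hσ => ?_⟩, fun p =>
      (h₅ p).isSubgamePerfect.mono (by linarith [hle3 p])⟩
    -- Both utilities are compared with the mean, not with the value: the gain is at most 2(D+1)²ε,
    -- whereas passing through the value would give 2(D+1)(D+2)ε. The four errors η/4 add up to η.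
    · linarith [hu₁ σ hσ, hu₂ _ hs₂]
    · linarith [hu₂ σ hσ, hu₁ _ hs₁]

/-- The table at the root is a function of the tapes below it, and the product form of `tapeMeasure`
makes these independent of the tapes at the root. -/
theorem ae_searchConverges {μ : Measure Ω} [IsProbabilityMeasure μ] {ε : ℝ} (hε : 0 ≤ ε)
    (hHC : A.HannanConsistent μ ε) (hGE : A.GuaranteedExploration μ) (G : SMGame) :
    ∀ᵐ τ ∂(G.tapeMeasure μ), G.SearchConverges A ε τ := by
  induction G with
  | terminal u => exact .of_forall fun τ => searchConverges_terminal A u ε τ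
  | node m n c ih =>
    change ∀ᵐ τ : (Ω × Ω) × (∀ p, Tapes Ω (c p))
      ∂((μ.prod μ).prod (Measure.pi fun p => tapeMeasure μ (c p))),
      (node m n c).SearchConverges A ε τ
    have htab : ∀ past i j,
        DiscretelyMeasurable fun τ : ∀ p, Tapes Ω (c p) => rootTable A c τ past i j :=
      fun past i j => (discretelyMeasurable_returned A (c (i, j)) _).comp_measurable
        (measurable_pi_apply (i, j))
    have hmem : ∀ (τ : ∀ p, Tapes Ω (c p)) past i j,
        rootTable A c τ past i j ∈ Set.Icc (0 : ℝ) 1 :=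
      fun τ past i j => returned_mem_Icc A _ _ _
    have hc : ∀ᵐ τ : (Ω × Ω) × (∀ p, Tapes Ω (c p))
        ∂((μ.prod μ).prod (Measure.pi fun p => tapeMeasure μ (c p))),
        ∀ p, (c p).SearchConverges A ε (τ.2 p) :=
      ae_all_iff.2 fun p => Measure.quasiMeasurePreserving_snd.ae
        ((Measure.quasiMeasurePreserving_eval (fun p => tapeMeasure μ (c p)) p).ae (ih p))
    filter_upwards [hc, A.ae_tendsto_count_playBoth hGE htab hmem,
      A.ae_limsup_rowRegret_le hHC htab hmem, A.ae_limsup_rowRegret_flip_le hHC htab hmem]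
      with τ h₁ h₂ h₃ h₄
    exact searchConverges_node A c hε τ h₁ h₂ h₃ h₄

end SMGame

theorem theorem4p11 {Ω : Type*} [MeasurableSpace Ω] (μ : Measure Ω) [IsProbabilityMeasure μ]
    (A : SelectionAlgorithm Ω) (ε : ℝ) (hε : 0 < ε)
    (hHC : A.HannanConsistent μ ε) (hGE : A.GuaranteedExploration μ)
    (G : SMGame) (δ : ℝ) (hδ : 0 < δ) :
    ∀ᵐ τ ∂(G.tapeMeasure μ), ∃ t₀ : ℕ, ∀ t ≥ t₀,
      G.IsSubgamePerfect ((2 * (G.depth : ℝ) ^ 2 + δ) * ε)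
        (G.empirical₁ (G.search A τ t)) (G.empirical₂ (G.search A τ t)) := by
  filter_upwards [SMGame.ae_searchConverges A hε.le hHC hGE G] with τ h
  -- The slack η = δε is positive because ε > 0.
  refine Filter.eventually_atTop.1 ((h (δ * ε) (by positivity)).mono fun t ht => ?_)
  exact ht.isSubgamePerfect.mono (by linarith)
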